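/- For a partial computable function $D\colon\{0,1\}^*\times\{0,1\}^*\to\{0,1\}^*$ (a decompressor) and binary strings $x,y$ let $$K_D(x\mid y)=\min\{|p| : p\in\{0,1\}^*,\ D(p,y)=x\}$$ (with value $\infty$ if there is no such $p$). Call $D$ optimal if for every partial computable $D'$ there is a constant $C$ such that $K_D(x\mid y)\le K_{D'}(x\mid y)+C$ for all $x,y$. Fix any optimal decompressor $D$ and write $K(x\mid y)=K_D(x\mid y)$ and $K(x)=K(x\mid\Lambda)$, where $\Lambda$ is the empty string. For every $k\ge 1$ fix any computable bijection between $(\{0,1\}^*)^k$ and $\{0,1\}^*$ and any computable bijection between the finite subsets of $(\{0,1\}^*)^k$ and $\{0,1\}^*$ (computable in both directions, a finite set being given by a list of its elements); complexities that involve $k$-tuples of strings or finite sets of such tuples are the complexities of their images under these bijections. For a non-empty finite set $A\subseteq(\{0,1\}^*)^k$ let $i(A)=\max\{K(A\mid x): x\in A\}$. For every $k\ge1$ there exists $\Gamma>0$ such that for every $n\ge 0$, for every set $\Pi=U_1\times\dots\times U_k$ with $U_1,\dots,U_k\subseteq\{0,1\}^n$, and for every tuple $(x_1,\dots,x_k)\in\Pi$,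 if $i(\Pi)+n\ge 2$, then $$K(\Pi\mid x_1)+\dots+K(\Pi\mid x_k)\ \le\ (k-1)\,K(\Pi)+i(\Pi)+\Gamma\cdot\log_2\bigl(i(\Pi)+n\bigr).$$ -/

import Mathlib

/-- Binary strings, the elements of `{0,1}^*`. -/
abbrev BinStr : Type := List Bool

/-- The conditional complexity `K_D(x | y)` of the string `x` given the string `y` with respect to
the decompressor `D`: the least length of a program `p` with `D(p, y) = x`. It is `⊤` if there is
no such program. -/
noncomputable def condComplexity (D : BinStr → BinStr →. BinStr) (x y : BinStr) : ℕ∞ :=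
  ⨅ p : BinStr, ⨅ _ : x ∈ D p y, (p.length : ℕ∞)

/-- `D` is an optimal decompressor: it is partial computable, and its complexity function is
minimal, up to an additive constant, among those of all partial computable decompressors. -/
def IsOptimalDecompressor (D : BinStr → BinStr →. BinStr) : Prop :=
  Partrec₂ D ∧ ∀ D' : BinStr → BinStr →. BinStr, Partrec₂ D' →
    ∃ C : ℕ, ∀ x y : BinStr, condComplexity D x y ≤ condComplexity D' x y + C

/-- For an optimal decompressor all complexities are finite, so that passing from `ℕ∞` to `ℕ`
below loses nothing. -/
theorem IsOptimalDecompressor.condComplexity_ne_top {D : BinStr → BinStr →. BinStr}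
    (hD : IsOptimalDecompressor D) (x y : BinStr) : condComplexity D x y ≠ ⊤ := by
  obtain ⟨C, hC⟩ := hD.2 (fun p _ => Part.some p) Computable.fst.partrec
  have h : condComplexity (fun p _ => Part.some p) x y ≤ (x.length : ℕ∞) :=
    iInf₂_le_of_le x (Part.mem_some x) le_rfl
  refine ne_top_of_le_ne_top ?_ ((hC x y).trans (add_le_add_left h _))
  exact_mod_cast ENat.natCast_ne_top (x.length + C)

/-- The complexity `K(x | y)` as a natural number (meant for an optimal decompressor `D`). -/
noncomputable def K (D : BinStr → BinStr →. BinStr) (x y : BinStr) : ℕ :=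
  (condComplexity D x y).toNat

/-- `c` is a computable bijection between `k`-tuples of binary strings and binary strings. -/
def IsTupleCoding {k : ℕ} (c : (Fin k → BinStr) ≃ BinStr) : Prop :=
  Computable c ∧ Computable c.symm

/-- `e` is a computable bijection between finite sets of `k`-tuples of binary strings and binary
strings: the code of a finite set can be computed from any list of its elements, and a list of the
elements of a finite set can be computed from its code. -/
def IsSetCoding {k : ℕ} (e : Finset (Fin k → BinStr) ≃ BinStr) : Prop :=
  Computable (fun l : List (Fin k → BinStr) => e l.toFinset) ∧
    ∃ g : BinStr → List (Fin k → BinStr), Computable g ∧ ∀ s, (g s).toFinset = e.symm s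

/-- The irregularity parameter `i(A) = max {K(A | x) : x ∈ A}` of a (non-empty) finite set `A` of
`k`-tuples of strings, where sets and tuples are replaced by their codes. -/
noncomputable def irregularity {k : ℕ} (D : BinStr → BinStr →. BinStr)
    (c : (Fin k → BinStr) ≃ BinStr) (e : Finset (Fin k → BinStr) ≃ BinStr)
    (A : Finset (Fin k → BinStr)) : ℕ :=
  A.sup fun x => K D (e A) (c x)

/-!
Write `w` for the code of `Π`, `s = K(w)`, `i = i(Π)` and `a_j = K(w | x_j)`; all equalities below
are up to `O(log (i + n))`. An element of `Π` has complexity at most `k n`, and given it `w` has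
complexity at most `i`, so `s` and the `a_j` are at most about `k n + i`
(`exists_K_le_of_mem`), and all numerical parameters can be given at the cost of the error term.

The only way in which upper bounds on complexities are obtained is that an element of an r.e. set
with at most `2 ^ m` elements has a description of `m` bits, given the parameters of the set
(`exists_K_le_of_encard_le`).

The tuple `(x_1, …, x_k)` itself may be atypical in `Π`, so it is replaced by the product of the
sets `T_j = {y ∈ U_j : K(w | y) ≥ a_j} ∋ x_j`, of sizes about `2 ^ t_j`. Every `y ∈ T_j` belongs to
the set `T_j(w')` for at least `2 ^ a_j` of the `2 ^ s` sets with codes `w'` of complexity at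
most `s`, since otherwise `w` would be simple given `y`. As every such `T_j(w')` has about
`2 ^ t_j` elements, `T_j` lies in a set `H_j` of at most `2 ^ (s + t_j - a_j)` elements that does
not depend on `w` (`exists_heavy_set`). The sets `T_j(w')` are not r.e., but they can be replaced by
r.e. sets that are hardly larger, because a set whose complement is r.e. can be approximated from
above once its size is approximately known (`REPred.exists_thinning`).

Now all `2 ^ (∑ t_j)` elements `z` of `T_1 × … × T_k` lie in `H_1 × … × H_k` and satisfy
`K(w | z) ≤ i`. For each `z` in `H_1 × … × H_k` there are at most `2 ^ i` codes `w'` with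
`K(w' | z) ≤ i`, so by double counting at most `2 ^ (i + ∑ (s + t_j - a_j) - ∑ t_j)` codes `w'` are
like `w` in this respect. Hence `s ≤ i + k s - ∑ a_j` (`exists_K_le_of_heavy`), which is the
inequality.
-/

/-! ### Recursively enumerable predicates -/

/-- Normal form of an r.e. predicate: it is the union of an increasing sequence of primitive
recursive predicates, indexed by the number of steps of the enumeration. -/
theorem REPred.exists_stage {α : Type*} [Primcodable α] {p : α → Prop} (hp : REPred p) :
    ∃ w : α → ℕ → Prop, PrimrecRel w ∧ (∀ a m n, m ≤ n → w a m → w a n) ∧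
      ∀ a, p a ↔ ∃ t, w a t := by
  obtain ⟨code, hcode⟩ := Nat.Partrec.Code.exists_code.1 hp
  refine ⟨fun a t => (code.evaln t (Encodable.encode a)).isSome = true, ?_, ?_, ?_⟩
  · refine Primrec.eq.comp (Primrec.option_isSome.comp (Nat.Partrec.Code.primrec_evaln.comp
      ((Primrec.snd.pair (Primrec.const code)).pair (Primrec.encode.comp Primrec.fst))))
      (Primrec.const true)
  · intro a m n hmn h
    obtain ⟨v, hv⟩ := Option.isSome_iff_exists.1 h
    exact Option.isSome_iff_exists.2 ⟨v, Nat.Partrec.Code.evaln_mono hmn hv⟩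
  · intro a
    have h1 : p a ↔ (code.eval (Encodable.encode a)).Dom := by
      rw [hcode]
      simp [Part.bind, Part.assert]
    rw [h1, Part.dom_iff_mem]
    constructor
    · rintro ⟨v, hv⟩
      obtain ⟨t, ht⟩ := Nat.Partrec.Code.evaln_complete.1 hv
      exact ⟨t, Option.isSome_iff_exists.2 ⟨v, ht⟩⟩
    · rintro ⟨t, ht⟩
      obtain ⟨v, hv⟩ := Option.isSome_iff_exists.1 ht
      exact ⟨v, Nat.Partrec.Code.evaln_sound hv⟩

theorem REPred.exists_nat_of_computablePred {α : Type*} [Primcodable α] {w : α → ℕ → Prop}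
    (hw : ComputablePred fun x : α × ℕ => w x.1 x.2) : REPred fun a => ∃ t, w a t := by
  obtain ⟨f, hf, hfw⟩ := ComputablePred.computable_iff.1 hw
  have h : Partrec fun a => Nat.rfind ((fun t => f (a, t) : ℕ → Bool) : ℕ →. Bool) :=
    Partrec.rfind hf.partrec
  refine h.dom_re.of_eq fun a => Nat.rfind_dom'.trans ?_
  have hfw' : ∀ t, w a t ↔ f (a, t) = true := fun t => by
    have := congrFun hfw (a, t)
    simpa using this
  constructor
  · rintro ⟨t, ht, -⟩
    exact ⟨t, (hfw' t).2 (Part.mem_some_iff.1 ht).symm⟩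
  · rintro ⟨t, ht⟩
    exact ⟨t, Part.mem_some_iff.2 ((hfw' t).1 ht).symm, fun _ => trivial⟩

theorem REPred.comp {α β : Type*} [Primcodable α] [Primcodable β] {p : β → Prop} (hp : REPred p)
    {f : α → β} (hf : Computable f) : REPred fun a => p (f a) :=
  Partrec.comp hp hf

theorem REPred.and {α : Type*} [Primcodable α] {p q : α → Prop} (hp : REPred p) (hq : REPred q) :
    REPred fun a => p a ∧ q a := by
  have hq' : Partrec₂ fun (a : α) (_ : Unit) => Part.assert (q a) fun _ => Part.some () :=
    Partrec.comp hq Computable.fst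
  have h := Partrec.bind hp hq'
  refine h.dom_re.of_eq fun a => ?_
  simp [Part.assert, Part.bind]

theorem PrimrecPred.rePred {α : Type*} [Primcodable α] {p : α → Prop} (hp : PrimrecPred p) :
    REPred p :=
  hp.computablePred.to_re

theorem REPred.exists {α β : Type*} [Primcodable α] [Primcodable β] {p : α × β → Prop}
    (hp : REPred p) : REPred fun a => ∃ b, p (a, b) := by
  classical
  obtain ⟨w, hw, -, hpw⟩ := hp.exists_stage
  let v : α → ℕ → Bool := fun a n =>
    ((Encodable.decode n.unpair.1 : Option β).casesOn false fun b => decide (w (a, b) n.unpair.2))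
  have hv : Primrec fun x : α × ℕ => v x.1 x.2 := by
    refine Primrec.option_casesOn (Primrec.decode.comp
      (Primrec.fst.comp (Primrec.unpair.comp Primrec.snd))) (Primrec.const false) ?_
    exact hw.decide.comp ((Primrec.fst.comp Primrec.fst).pair Primrec.snd)
      (Primrec.snd.comp (Primrec.unpair.comp (Primrec.snd.comp Primrec.fst)))
  have hv' : PrimrecPred fun x : α × ℕ => v x.1 x.2 = true := Primrec.eq.comp hv (.const true)
  refine (REPred.exists_nat_of_computablePred (w := fun a n => v a n = true)
    hv'.computablePred).of_eq fun a => ?_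
  constructor
  · rintro ⟨n, hn⟩
    rcases hd : (Encodable.decode n.unpair.1 : Option β) with _ | b
    · simp [v, hd] at hn
    · simp only [v, hd, decide_eq_true_eq] at hn
      exact ⟨b, (hpw _).2 ⟨_, hn⟩⟩
  · rintro ⟨b, hb⟩
    obtain ⟨t, ht⟩ := (hpw _).1 hb
    exact ⟨Nat.pair (Encodable.encode b) t, by simp [v, ht]⟩

theorem REPred.forall_mem_list {α β : Type*} [Primcodable α] [Primcodable β] {p : α × β → Prop}
    (hp : REPred p) : REPred fun x : α × List β => ∀ b ∈ x.2, p (x.1, b) := by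
  obtain ⟨w, hw, hmono, hpw⟩ := hp.exists_stage
  have h1 : PrimrecRel fun (b : β) (y : α × ℕ) => w (y.1, b) y.2 :=
    PrimrecRel.comp hw ((Primrec.fst.comp Primrec.snd).pair Primrec.fst)
      (Primrec.snd.comp Primrec.snd)
  have h2 : PrimrecPred fun x : (α × List β) × ℕ => ∀ b ∈ x.1.2, w (x.1.1, b) x.2 :=
    PrimrecRel.comp h1.forall_mem_list (Primrec.snd.comp Primrec.fst)
      ((Primrec.fst.comp Primrec.fst).pair Primrec.snd)
  refine (REPred.exists_nat_of_computablePred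
    (w := fun (x : α × List β) t => ∀ b ∈ x.2, w (x.1, b) t) h2.computablePred).of_eq ?_
  rintro ⟨a, l⟩
  simp only [hpw]
  constructor
  · rintro ⟨t, ht⟩ b hb
    exact ⟨t, ht b hb⟩
  · intro h
    induction l with
    | nil => exact ⟨0, by simp⟩
    | cons b l ih =>
      obtain ⟨t₁, ht₁⟩ := ih fun b' hb' => h b' (by simp [hb'])
      obtain ⟨t₂, ht₂⟩ := h b (by simp)
      refine ⟨max t₁ t₂, fun b' hb' => ?_⟩
      rcases List.mem_cons.1 hb' with rfl | hb'
      · exact hmono _ _ _ (le_max_right _ _) ht₂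
      · exact hmono _ _ _ (le_max_left _ _) (ht₁ b' hb')

theorem REPred.forall_fin {α : Type*} [Primcodable α] {k : ℕ} {p : α × Fin k → Prop}
    (hp : REPred p) : REPred fun a => ∀ j, p (a, j) :=
  (hp.forall_mem_list.comp (Computable.id.pair (Computable.const (List.finRange k)))).of_eq
    fun a => by simp

theorem PrimrecPred.list_nodup {α : Type*} [Primcodable α] :
    PrimrecPred (List.Nodup : List α → Prop) := by
  classical
  have h : Primrec fun l : List α => (List.rec (motive := fun _ => Bool) true
      (fun b l ih => !(decide (∃ x ∈ l, x = b)) && ih) l : Bool) := by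
    refine Primrec.list_rec (f := fun l : List α => l) (g := fun _ => true)
      (h := fun _ x => !(decide (∃ y ∈ x.2.1, y = x.1)) && x.2.2) Primrec.id (.const true) ?_
    have h1 : PrimrecPred fun x : List α × (α × List α × Bool) => ∃ y ∈ x.2.2.1, y = x.2.1 :=
      PrimrecRel.comp (PrimrecRel.exists_mem_list (R := fun y b : α => y = b) Primrec.eq)
      (Primrec.fst.comp (Primrec.snd.comp Primrec.snd)) (Primrec.fst.comp Primrec.snd)
    exact Primrec.and.comp (Primrec.not.comp h1.decide)
      (Primrec.snd.comp (Primrec.snd.comp Primrec.snd))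
  have h' : PrimrecPred fun l : List α => (List.rec (motive := fun _ => Bool) true
      (fun b l ih => !(decide (∃ x ∈ l, x = b)) && ih) l : Bool) = true :=
    Primrec.eq.comp h (.const true)
  refine h'.of_eq fun l => ?_
  induction l with
  | nil => simp
  | cons b l ih => simp [← ih]

/-- "At least `N` elements satisfy `p`" is r.e. uniformly in `N`. -/
theorem REPred.le_encard {α β : Type*} [Primcodable α] [Primcodable β] {p : α × β → Prop}
    (hp : REPred p) : REPred fun x : α × ℕ => (x.2 : ℕ∞) ≤ {b | p (x.1, b)}.encard := by
  have h1 : REPred fun y : (α × ℕ) × List β => y.2.Nodup ∧ y.1.2 = y.2.length :=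
    (PrimrecPred.and (PrimrecPred.list_nodup.comp Primrec.snd)
      (Primrec.eq.comp (Primrec.snd.comp Primrec.fst)
        (Primrec.list_length.comp Primrec.snd))).rePred
  have h2 : REPred fun y : (α × ℕ) × List β => ∀ b ∈ y.2, p (y.1.1, b) :=
    hp.forall_mem_list.comp ((Computable.fst.comp Computable.fst).pair Computable.snd)
  refine (h1.and h2).exists.of_eq ?_
  classical
  rintro ⟨a, N⟩
  constructor
  · rintro ⟨l, ⟨hnd, hl⟩, hmem⟩
    have : ((l.toFinset : Set β)).encard = N := by
      rw [Set.encard_coe_eq_coe_finsetCard, List.toFinset_card_of_nodup hnd]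
      exact_mod_cast hl.symm
    rw [← this]
    exact Set.encard_le_encard fun b hb => hmem b (by simpa using hb)
  · intro h
    obtain ⟨t, ht, htN⟩ := Set.exists_subset_encard_eq h
    have hfin : t.Finite := Set.finite_of_encard_eq_coe htN
    refine ⟨hfin.toFinset.toList, ⟨Finset.nodup_toList _, ?_⟩, fun b hb => ht (by simpa using hb)⟩
    rw [Finset.length_toList]
    rw [hfin.encard_eq_coe_toFinset_card] at htN
    exact_mod_cast htN.symm

/-- The complement, inside a finite list, of a set which is r.e. uniformly in `a` need not be
r.e.; but its elements can be enumerated, along with at most `m` candidates in all, as soon as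
their number is known to be at most `m`: wait until at most `m` elements of the list have not
been enumerated into `p`. -/
theorem REPred.exists_thinning {α β : Type*} [Primcodable α] [Primcodable β] {p : α × β → Prop}
    (hp : REPred p) : ∃ q : (α × List β × ℕ) × β → Prop, REPred q ∧
      (∀ a l (m : ℕ), {b | q ((a, l, m), b)}.encard ≤ m) ∧
      ∀ a l (m : ℕ), {b | b ∈ l ∧ ¬ p (a, b)}.encard ≤ m →
        ∀ b ∈ l, ¬ p (a, b) → q ((a, l, m), b) := by
  classical
  obtain ⟨w, hw, hmono, hpw⟩ := hp.exists_stage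
  -- `l'` lists the elements of `l` that are left at stage `t`
  let r : ((α × List β × ℕ) × β) × (List β × ℕ) → Prop := fun x =>
    x.2.1.length ≤ x.1.1.2.2 ∧ (∀ b' ∈ x.1.1.2.1, w (x.1.1.1, b') x.2.2 ∨ b' ∈ x.2.1) ∧
      (∃ b' ∈ x.1.1.2.1, b' = x.1.2) ∧ ¬ w (x.1.1.1, x.1.2) x.2.2
  have hr : PrimrecPred r := by
    have hparam : Primrec fun x : ((α × List β × ℕ) × β) × (List β × ℕ) => x.1.1.1 :=
      Primrec.fst.comp (Primrec.fst.comp Primrec.fst)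
    have hlist : Primrec fun x : ((α × List β × ℕ) × β) × (List β × ℕ) => x.1.1.2.1 :=
      Primrec.fst.comp (Primrec.snd.comp (Primrec.fst.comp Primrec.fst))
    have hnum : Primrec fun x : ((α × List β × ℕ) × β) × (List β × ℕ) => x.1.1.2.2 :=
      Primrec.snd.comp (Primrec.snd.comp (Primrec.fst.comp Primrec.fst))
    refine .and (Primrec.nat_le.comp (Primrec.list_length.comp (Primrec.fst.comp Primrec.snd))
      hnum) (.and ?_ (.and ?_ ?_))
    · have h1 : PrimrecRel fun (b' : β) (y : α × List β × ℕ) =>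
          w (y.1, b') y.2.2 ∨ ∃ b'' ∈ y.2.1, b'' = b' := by
        refine PrimrecPred.or (PrimrecRel.comp hw
          ((Primrec.fst.comp Primrec.snd).pair Primrec.fst)
          (Primrec.snd.comp (Primrec.snd.comp Primrec.snd))) ?_
        exact PrimrecRel.comp
          (PrimrecRel.exists_mem_list (R := fun b'' b' : β => b'' = b') Primrec.eq)
          (Primrec.fst.comp (Primrec.snd.comp Primrec.snd)) Primrec.fst
      refine (PrimrecRel.comp h1.forall_mem_list hlist (hparam.pair Primrec.snd)).of_eq ?_
      simp
    · exact PrimrecRel.comp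
        (PrimrecRel.exists_mem_list (R := fun b'' b' : β => b'' = b') Primrec.eq)
        hlist (Primrec.snd.comp Primrec.fst)
    · exact PrimrecPred.not (PrimrecRel.comp hw (hparam.pair (Primrec.snd.comp Primrec.fst))
        (Primrec.snd.comp Primrec.snd))
  refine ⟨fun x => ∃ y, r (x, y), hr.rePred.exists, ?_, ?_⟩
  · intro a l m
    by_cases hex : ∃ t, ∃ l' : List β, l'.length ≤ m ∧ ∀ b' ∈ l, w (a, b') t ∨ b' ∈ l'
    · -- everything still present at a later stage is present at the first suitable one
      obtain ⟨l', hl', hall⟩ := Nat.find_spec hex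
      have hsub : {b | ∃ y, r (((a, l, m), b), y)} ⊆ (l'.toFinset : Set β) := by
        rintro b ⟨⟨l'', t⟩, hlen, hcov, ⟨b', hb', rfl⟩, hnw⟩
        have ht : Nat.find hex ≤ t := Nat.find_min' hex ⟨l'', hlen, hcov⟩
        rcases hall _ hb' with h | h
        · exact absurd (hmono _ _ _ ht h) hnw
        · simpa using h
      refine (Set.encard_le_encard hsub).trans ?_
      rw [Set.encard_coe_eq_coe_finsetCard]
      exact_mod_cast (List.toFinset_card_le l').trans hl'
    · have : {b | ∃ y, r (((a, l, m), b), y)} = ∅ := by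
        ext b
        refine ⟨?_, False.elim⟩
        rintro ⟨⟨l'', t⟩, hlen, hcov, -⟩
        exact hex ⟨t, l'', hlen, hcov⟩
      exact this ▸ (by simp)
  · intro a l m hm b hb hpb
    have hfin : {b | b ∈ l ∧ ¬ p (a, b)}.Finite := Set.Finite.subset l.toFinset.finite_toSet
      fun b hb => by simpa using hb.1
    have hstage : ∃ t, ∀ b' ∈ l, p (a, b') → w (a, b') t := by
      clear hm hb hfin
      induction l with
      | nil => exact ⟨0, by simp⟩
      | cons b₀ l ih =>
        obtain ⟨t₁, ht₁⟩ := ih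
        by_cases hb₀ : p (a, b₀)
        · obtain ⟨t₂, ht₂⟩ := (hpw _).1 hb₀
          refine ⟨max t₁ t₂, fun b' hb' hp' => ?_⟩
          rcases List.mem_cons.1 hb' with rfl | hb'
          · exact hmono _ _ _ (le_max_right _ _) ht₂
          · exact hmono _ _ _ (le_max_left _ _) (ht₁ b' hb' hp')
        · refine ⟨t₁, fun b' hb' hp' => ?_⟩
          rcases List.mem_cons.1 hb' with rfl | hb'
          · exact absurd hp' hb₀
          · exact ht₁ b' hb' hp'
    obtain ⟨t, ht⟩ := hstage
    refine ⟨⟨hfin.toFinset.toList, t⟩, ?_, ?_, ⟨b, hb, rfl⟩, fun h => hpb ((hpw _).2 ⟨_, h⟩)⟩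
    · rw [hfin.encard_eq_coe_toFinset_card] at hm
      simpa using (by exact_mod_cast hm : hfin.toFinset.card ≤ m)
    · intro b' hb'
      by_cases hp' : p (a, b')
      · exact Or.inl (ht b' hb' hp')
      · exact Or.inr (by simpa using ⟨hb', hp'⟩)

theorem primrec_two_pow : Primrec fun m : ℕ => 2 ^ m := by
  refine (Primrec.nat_rec' (f := fun m : ℕ => m) (g := fun _ => 1) (h := fun _ x => 2 * x.2)
    Primrec.id (.const 1) (Primrec.nat_mul.comp (.const 2)
      (Primrec.snd.comp Primrec.snd))).of_eq fun m => ?_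
  induction m with
  | zero => rfl
  | succ m ih => rw [pow_succ, ← ih, mul_comm]

/-! ### Describing an element of an r.e. set by its number in the enumeration -/

/-- The number whose binary digits, most significant first, are the elements of the list. -/
def bitsVal (l : List Bool) : ℕ :=
  l.foldl (fun n b => 2 * n + b.toNat) 0

theorem primrec_bitsVal : Primrec bitsVal := by
  refine Primrec.list_foldl (f := fun l : List Bool => l) (g := fun _ => 0)
    (h := fun _ x => 2 * x.1 + x.2.toNat) Primrec.id (.const 0) ?_
  exact Primrec.nat_add.comp
    (Primrec.nat_mul.comp (.const 2) (Primrec.fst.comp Primrec.snd))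
    ((Primrec.dom_bool Bool.toNat).comp (Primrec.snd.comp Primrec.snd))

theorem exists_bitsVal_eq (m r : ℕ) (h : r < 2 ^ m) :
    ∃ l : List Bool, l.length = m ∧ bitsVal l = r := by
  induction m generalizing r with
  | zero => exact ⟨[], rfl, by simp at h; simp [bitsVal, h]⟩
  | succ m ih =>
    obtain ⟨l, hl, hv⟩ := ih (r / 2) (by rw [pow_succ] at h; omega)
    refine ⟨l ++ [decide (r % 2 = 1)], by simp [hl], ?_⟩
    unfold bitsVal at hv ⊢
    rw [List.foldl_append, hv]
    rcases Nat.mod_two_eq_zero_or_one r with h0 | h0 <;> simp [h0] <;> omega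

theorem K_le_iff {D : BinStr → BinStr →. BinStr} (hD : IsOptimalDecompressor D) {x y : BinStr}
    {m : ℕ} : K D x y ≤ m ↔ ∃ p : BinStr, p.length ≤ m ∧ x ∈ D p y := by
  unfold K
  rw [← ENat.natCast_le_natCast, ENat.natCast_toNat (hD.condComplexity_ne_top x y)]
  constructor
  · intro h
    by_contra! hcon
    have : ((m + 1 : ℕ) : ℕ∞) ≤ condComplexity D x y := by
      refine le_iInf₂ fun p hp => ?_
      by_contra hlt
      exact hcon p (by
        have : p.length < m + 1 := by exact_mod_cast not_le.1 hlt
        omega) hp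
    have := this.trans h
    norm_cast at this
    omega
  · rintro ⟨p, hp, hx⟩
    exact (iInf₂_le p hx).trans (by exact_mod_cast hp)

theorem rePred_K_le {D : BinStr → BinStr →. BinStr} (hD : IsOptimalDecompressor D) :
    REPred fun x : (BinStr × BinStr) × ℕ => K D x.1.1 x.1.2 ≤ x.2 := by
  have h1 : REPred fun y : ((BinStr × BinStr) × ℕ) × BinStr => y.2.length ≤ y.1.2 :=
    PrimrecPred.rePred (Primrec.nat_le.comp (Primrec.list_length.comp Primrec.snd)
      (Primrec.snd.comp Primrec.fst))
  have h2 : REPred fun y : ((BinStr × BinStr) × ℕ) × BinStr => y.1.1.1 ∈ D y.2 y.1.1.2 := by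
    have hrun : Partrec fun y : ((BinStr × BinStr) × ℕ) × BinStr => D y.2 y.1.1.2 :=
      Partrec₂.comp hD.1 Computable.snd
        (Computable.snd.comp (Computable.fst.comp Computable.fst))
    have heq : REPred fun z : (((BinStr × BinStr) × ℕ) × BinStr) × BinStr => z.2 = z.1.1.1.1 :=
      PrimrecPred.rePred (Primrec.eq.comp Primrec.snd (Primrec.fst.comp
        (Primrec.fst.comp (Primrec.fst.comp Primrec.fst))))
    have heq' : Partrec₂ fun (y : ((BinStr × BinStr) × ℕ) × BinStr) (z : BinStr) =>
        Part.assert (z = y.1.1.1) fun _ => Part.some () := heq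
    refine (hrun.bind heq').dom_re.of_eq fun y => ?_
    rw [Part.dom_iff_mem]
    simp [Part.mem_bind_iff, Part.mem_assert_iff]
  exact (h1.and h2).exists.of_eq fun x => Iff.symm (K_le_iff hD)

theorem REPred.K_le {D : BinStr → BinStr →. BinStr} (hD : IsOptimalDecompressor D)
    {α : Type*} [Primcodable α] {f g : α → BinStr} {m : α → ℕ} (hf : Computable f)
    (hg : Computable g) (hm : Computable m) : REPred fun a => K D (f a) (g a) ≤ m a :=
  (rePred_K_le hD).comp (f := fun a => ((f a, g a), m a)) ((hf.pair hg).pair hm)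

theorem REPred.K_lt {D : BinStr → BinStr →. BinStr} (hD : IsOptimalDecompressor D)
    {α : Type*} [Primcodable α] {f g : α → BinStr} {m : α → ℕ} (hf : Computable f)
    (hg : Computable g) (hm : Computable m) : REPred fun a => K D (f a) (g a) < m a := by
  have h1 : REPred fun a => 0 < m a :=
    REPred.comp (PrimrecPred.rePred (p := fun n => 0 < n)
      (Primrec.nat_lt.comp (.const 0) Primrec.id)) hm
  refine (h1.and (REPred.K_le hD hf hg (Computable.pred.comp hm))).of_eq fun a => ?_
  rw [Nat.pred_eq_sub_one]
  omega

/-- The length, in binary, of the numerical code of `a`. The code is that of the `Primcodable`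
instance; the type `Fin k → α` also carries an `Encodable` instance with different codes. -/
def codeSize {α : Type*} [Primcodable α] (a : α) : ℕ :=
  Nat.size (Encodable.encode a)

/-- An element of an r.e. set with at most `2 ^ m` elements is determined by its number in the
enumeration, written with `m` bits, and by the parameters `q` of the set, which come first and in
self-delimiting form. The condition `y` may be used in the enumeration. -/
theorem exists_K_le_of_encard_le {D : BinStr → BinStr →. BinStr} (hD : IsOptimalDecompressor D)
    {σ : Type*} [Primcodable σ] {P : (σ × BinStr) × BinStr → Prop} (hP : REPred P) :
    ∃ C : ℕ, ∀ q y x m, P ((q, y), x) → {x' | P ((q, y), x')}.encard ≤ (2 ^ m : ℕ) →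
      K D x y ≤ m + 2 * codeSize q + C := by
  classical
  obtain ⟨w, hw, -, hPw⟩ := hP.exists_stage
  -- the enumeration: step `t` yields at most one element
  let f : σ × BinStr → ℕ → Option BinStr := fun z t =>
    (Encodable.decode t.unpair.1 : Option BinStr).bind fun x =>
      if w (z, x) t.unpair.2 then some x else none
  have hf : Primrec₂ f := by
    refine Primrec.option_bind (Primrec.decode.comp
      (Primrec.fst.comp (Primrec.unpair.comp Primrec.snd))) ?_
    refine Primrec.ite ?_ (Primrec.option_some.comp Primrec.snd) (.const none)
    exact PrimrecRel.comp hw ((Primrec.fst.comp Primrec.fst).pair Primrec.snd)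
      (Primrec.snd.comp (Primrec.unpair.comp (Primrec.snd.comp Primrec.fst)))
  have hfP : ∀ z x, P (z, x) ↔ ∃ t, f z t = some x := by
    intro z x
    rw [hPw]
    constructor
    · rintro ⟨t, ht⟩
      exact ⟨Nat.pair (Encodable.encode x) t, by simp [f, ht]⟩
    · rintro ⟨t, ht⟩
      obtain ⟨x', -, hx'⟩ := Option.bind_eq_some_iff.1 ht
      split_ifs at hx' with h
      simp only [Option.some.injEq] at hx'
      exact ⟨_, hx' ▸ h⟩
  -- the steps at which a new element appears
  let nov : ℕ → σ × BinStr → Prop := fun t z => f z t ≠ none ∧ ∀ t' < t, f z t' ≠ f z t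
  have hnov : PrimrecRel nov := by
    refine PrimrecPred.and (PrimrecPred.not (Primrec.eq.comp
      (hf.comp Primrec.snd Primrec.fst) (.const none))) ?_
    have h1 : PrimrecRel fun (t' : ℕ) (y : ℕ × (σ × BinStr)) => f y.2 t' ≠ f y.2 y.1 :=
      PrimrecPred.not (Primrec.eq.comp (hf.comp (Primrec.snd.comp Primrec.snd) Primrec.fst)
        (hf.comp (Primrec.snd.comp Primrec.snd) (Primrec.fst.comp Primrec.snd)))
    refine (PrimrecRel.comp h1.forall_mem_list (Primrec.list_range.comp Primrec.fst)
      Primrec.id).of_eq fun x => ?_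
    simp
  let cnt : σ × BinStr → ℕ → ℕ := fun z t => ((List.range t).filter (nov · z)).length
  have hcnt : Primrec₂ cnt := Primrec.list_length.comp
    (hnov.listFilter.comp (Primrec.list_range.comp Primrec.snd) Primrec.fst)
  have hcount : ∀ z t, cnt z t = Nat.count (nov · z) t := by
    intro z t
    induction t with
    | zero => simp [cnt]
    | succ t ih =>
      rw [Nat.count_succ, ← ih]
      by_cases h : nov t z <;> simp [cnt, List.range_succ, h]
  -- a program is `1 ^ l 0 b r`, where `b`, of length `l`, is the code of `q`, and `r` is the number
  let len : BinStr → ℕ := fun p => p.idxOf false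
  let rest : BinStr → BinStr := fun p => p.drop (len p + 1)
  have hlen : Primrec len := Primrec.list_idxOf.comp (.const false) Primrec.id
  have hrest : Primrec rest :=
    Primrec.list_drop.comp (Primrec.succ.comp hlen) Primrec.id
  let g : BinStr × BinStr → ℕ → Option BinStr := fun u t =>
    (Encodable.decode (bitsVal ((rest u.1).take (len u.1))) : Option σ).bind fun q =>
      if nov t (q, u.2) ∧ cnt (q, u.2) t = bitsVal ((rest u.1).drop (len u.1)) then
        f (q, u.2) t else none
  have hg : Primrec₂ g := by
    have hpr : Primrec fun v : ((BinStr × BinStr) × ℕ) × σ => v.1.1.1 :=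
      Primrec.fst.comp (Primrec.fst.comp Primrec.fst)
    have hz : Primrec fun v : ((BinStr × BinStr) × ℕ) × σ => (v.2, v.1.1.2) :=
      Primrec.snd.pair (Primrec.snd.comp (Primrec.fst.comp Primrec.fst))
    have ht : Primrec fun v : ((BinStr × BinStr) × ℕ) × σ => v.1.2 :=
      Primrec.snd.comp Primrec.fst
    refine Primrec.option_bind (Primrec.decode.comp (primrec_bitsVal.comp
      (Primrec.list_take.comp (hlen.comp (Primrec.fst.comp Primrec.fst))
        (hrest.comp (Primrec.fst.comp Primrec.fst))))) ?_
    refine Primrec.ite (.and ?_ ?_) (hf.comp hz ht) (.const none)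
    · exact PrimrecRel.comp hnov ht hz
    · exact Primrec.eq.comp (hcnt.comp hz ht) (primrec_bitsVal.comp
        (Primrec.list_drop.comp (hlen.comp hpr) (hrest.comp hpr)))
  obtain ⟨C, hC⟩ := hD.2 (fun p y => Nat.rfindOpt (g (p, y)))
    (Partrec.rfindOpt (f := g) hg.to_comp)
  refine ⟨C + 1, fun q y x m hx hcard => ?_⟩
  set z : σ × BinStr := (q, y) with hz
  -- the first step `t₀` at which `x` appears, and its number among the new steps
  have hex := (hfP z x).1 hx
  set t₀ := Nat.find hex
  have ht₀ : f z t₀ = some x := Nat.find_spec hex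
  have hnov₀ : nov t₀ z := ⟨by simp [ht₀], fun t' ht' h =>
    Nat.find_min hex ht' (h.trans ht₀)⟩
  have hlt : cnt z t₀ < 2 ^ m := by
    let S : Finset ℕ := (Finset.range (t₀ + 1)).filter (nov · z)
    have hS : cnt z t₀ + 1 = S.card := by
      rw [hcount, ← Nat.count_eq_card_filter_range, Nat.count_succ, if_pos hnov₀]
    have hinj : Set.InjOn (fun t => (f z t).getD []) (S : Set ℕ) := by
      intro t ht t' ht' heq
      have h1 := (Finset.mem_filter.1 (Finset.mem_coe.1 ht)).2
      have h2 := (Finset.mem_filter.1 (Finset.mem_coe.1 ht')).2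
      obtain ⟨a, ha⟩ := Option.ne_none_iff_exists'.1 h1.1
      obtain ⟨b, hb⟩ := Option.ne_none_iff_exists'.1 h2.1
      have hab : f z t = f z t' := by simp only [ha, hb, Option.getD_some] at heq ⊢; rw [heq]
      rcases lt_trichotomy t t' with h | h | h
      · exact absurd hab (h2.2 _ h)
      · exact h
      · exact absurd hab.symm (h1.2 _ h)
    have hsub : (fun t => (f z t).getD []) '' (S : Set ℕ) ⊆ {x' | P ((q, y), x')} := by
      rintro _ ⟨t, ht, rfl⟩
      have h1 := (Finset.mem_filter.1 (Finset.mem_coe.1 ht)).2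
      obtain ⟨a, ha⟩ := Option.ne_none_iff_exists'.1 h1.1
      exact (hfP _ _).2 ⟨t, by
        change f z t = some ((f z t).getD [])
        rw [ha]; rfl⟩
    have := (Set.encard_le_encard hsub).trans hcard
    rw [hinj.encard_image, Set.encard_coe_eq_coe_finsetCard, ← hS] at this
    exact_mod_cast this
  obtain ⟨bq, hbq, hvq⟩ := exists_bitsVal_eq _ _ (Nat.lt_size_self (Encodable.encode q))
  obtain ⟨br, hbr, hvr⟩ := exists_bitsVal_eq _ _ hlt
  let p : BinStr := List.replicate bq.length true ++ false :: (bq ++ br)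
  have hplen : len p = bq.length := by
    simp [len, p, List.idxOf_append]
  have hprest : rest p = bq ++ br := by
    simp only [rest, hplen, p]
    simp [List.drop_append]
  have hgp : ∀ t, g (p, y) t = if nov t z ∧ cnt z t = cnt z t₀ then f z t else none := by
    intro t
    simp [g, hplen, hprest, hvq, hvr, ← hz]
  have hmem : x ∈ Nat.rfindOpt (g (p, y)) := by
    have hdom : (Nat.rfindOpt (g (p, y))).Dom :=
      Nat.rfindOpt_dom.2 ⟨t₀, x, by rw [hgp, if_pos ⟨hnov₀, rfl⟩, ht₀]; rfl⟩
    obtain ⟨x', hx'⟩ := Part.dom_iff_mem.1 hdom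
    obtain ⟨t, ht⟩ := Nat.rfindOpt_spec hx'
    rw [hgp] at ht
    split_ifs at ht with h
    · have : t = t₀ := by
        have h2 := h.2
        rw [hcount, hcount] at h2
        exact Nat.count_injective h.1 hnov₀ h2
      rw [this, ht₀] at ht
      have : x = x' := by simpa using ht
      exact this ▸ hx'
    · simp at ht
  have hle : condComplexity D x y ≤ ((m + 2 * codeSize q + (C + 1) : ℕ) : ℕ∞) := by
    refine (hC x y).trans ?_
    have h1 : condComplexity (fun p y => Nat.rfindOpt (g (p, y))) x y ≤ (p.length : ℕ∞) :=
      iInf₂_le p hmem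
    refine (add_le_add_left h1 _).trans ?_
    have h2 : p.length + C ≤ m + 2 * codeSize q + (C + 1) := by
      simp only [codeSize, p, List.length_append, List.length_replicate, List.length_cons, hbq, hbr]
      omega
    exact_mod_cast h2
  exact ENat.toNat_le_of_le_natCast hle

theorem encard_setOf_K_le {D : BinStr → BinStr →. BinStr} (hD : IsOptimalDecompressor D)
    (y : BinStr) (m : ℕ) : {x | K D x y ≤ m}.encard ≤ (2 ^ (m + 1) : ℕ) := by
  classical
  let F : BinStr → BinStr := fun p => if h : (D p y).Dom then (D p y).get h else []
  -- a program of length at most `m` is padded to length `m + 1` by a prefix `0 … 0 1`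
  let S : Finset BinStr := (Finset.univ : Finset (List.Vector Bool (m + 1))).image
    fun v => F (v.toList.dropWhile (!·)).tail
  have hsub : {x | K D x y ≤ m} ⊆ (S : Set BinStr) := by
    intro x hx
    obtain ⟨p, hp, hpx⟩ := (K_le_iff hD).1 hx
    refine Finset.mem_coe.2 (Finset.mem_image.2
      ⟨⟨List.replicate (m - p.length) false ++ true :: p, by simp; omega⟩, Finset.mem_univ _, ?_⟩)
    have hdrop : ((List.replicate (m - p.length) false ++ true :: p).dropWhile (!·)).tail = p := by
      rw [List.dropWhile_append_of_pos (by simp)]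
      simp
    have hdom : (D p y).Dom := Part.dom_iff_mem.2 ⟨x, hpx⟩
    change F ((List.replicate (m - p.length) false ++ true :: p).dropWhile (!·)).tail = x
    rw [hdrop]
    simp only [F, dif_pos hdom]
    exact Part.get_eq_of_mem hpx hdom
  refine (Set.encard_le_encard hsub).trans ?_
  rw [Set.encard_coe_eq_coe_finsetCard]
  exact_mod_cast Finset.card_image_le.trans (by simp [card_vector])

/-! ### Length of the description of the parameters -/

theorem size_pair_le {a b S : ℕ} (ha : Nat.size a ≤ S) (hb : Nat.size b ≤ S) :
    Nat.size (Nat.pair a b) ≤ 2 * S := by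
  rw [Nat.size_le] at *
  refine (Nat.pair_lt_max_add_one_sq a b).trans_le ?_
  rw [mul_comm, pow_mul]
  exact Nat.pow_le_pow_left (max_lt ha hb) 2

theorem codeSize_pair_le {α β : Type*} [Primcodable α] [Primcodable β] {a : α} {b : β} {S : ℕ}
    (ha : codeSize a ≤ S) (hb : codeSize b ≤ S) : codeSize (a, b) ≤ 2 * S := by
  unfold codeSize at *
  rw [Encodable.encode_prod_val]
  exact size_pair_le ha hb

theorem codeSize_nat (a : ℕ) : codeSize a = Nat.size a := rfl

theorem codeSize_fin {k : ℕ} (j : Fin k) : codeSize j ≤ Nat.size k :=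
  Nat.size_le_size j.2.le

theorem codeSize_list_le {α : Type*} [Primcodable α] {S : ℕ} (hS : 1 ≤ S) (l : List α)
    (hl : ∀ a ∈ l, codeSize a ≤ S) : codeSize l ≤ 3 ^ l.length * S := by
  unfold codeSize at *
  induction l with
  | nil => simp
  | cons a l ih =>
    have h1 := ih fun b hb => hl b (by simp [hb])
    have h2 : Nat.size (Encodable.encode a) ≤ 3 ^ l.length * S :=
      (hl a (by simp)).trans (Nat.le_mul_of_pos_left _ (by positivity))
    have h3 := size_pair_le h2 h1
    have h4 : 1 ≤ 3 ^ l.length * S := Nat.mul_pos (by positivity) hS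
    rw [Encodable.encode_list_cons, Nat.size_le]
    rw [Nat.size_le] at h3
    calc Nat.pair (Encodable.encode a) (Encodable.encode l) + 1
        < 2 ^ (2 * (3 ^ l.length * S)) + 2 ^ (2 * (3 ^ l.length * S)) := by
          have := Nat.one_le_two_pow (n := 2 * (3 ^ l.length * S)); omega
      _ = 2 ^ (2 * (3 ^ l.length * S) + 1) := by rw [pow_succ]; ring
      _ ≤ _ := Nat.pow_le_pow_right (by norm_num) (by rw [List.length_cons, pow_succ]; linarith)

theorem codeSize_pi_le {α : Type*} [Primcodable α] {k S : ℕ} (hS : 1 ≤ S) (f : Fin k → α)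
    (hf : ∀ j, codeSize (f j) ≤ S) : codeSize f ≤ 3 ^ k * S := by
  have h1 : codeSize f = codeSize ((Equiv.vectorEquivFin α k).symm f).toList := rfl
  have h2 : ((Equiv.vectorEquivFin α k).symm f).toList = List.ofFn f :=
    List.Vector.toList_ofFn f
  rw [h1, h2]
  simpa using codeSize_list_le hS (List.ofFn f) (by simpa [List.mem_ofFn] using hf)

theorem size_mul_le (a b : ℕ) : Nat.size (a * b) ≤ Nat.size a + Nat.size b := by
  rw [Nat.size_le, pow_add]
  exact Nat.mul_lt_mul'' (Nat.lt_size_self a) (Nat.lt_size_self b)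

theorem size_le_self (a : ℕ) : Nat.size a ≤ a :=
  Nat.size_le.2 Nat.lt_two_pow_self

/-! ### Counting -/

theorem encard_le_of_forall_finset {β : Type*} {B : Set β} {N : ℕ}
    (h : ∀ T : Finset β, (T : Set β) ⊆ B → T.card ≤ N) : B.encard ≤ N := by
  by_contra hcon
  obtain ⟨T, hT, hTc⟩ := Set.exists_subset_encard_eq (k := ((N + 1 : ℕ) : ℕ∞)) (s := B)
    (by simpa using Order.add_one_le_of_lt (not_le.1 hcon))
  have hfin : T.Finite := Set.finite_of_encard_eq_coe hTc
  have h1 := h hfin.toFinset (by simpa using hT)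
  rw [hfin.encard_eq_coe_toFinset_card] at hTc
  have : hfin.toFinset.card = N + 1 := by exact_mod_cast hTc
  omega

/-- Double counting of the pairs in a relation between `A` and `B`. -/
theorem encard_le_of_double_count {α β : Type*} {A : Set α} {B : Set β} (r : α → β → Prop)
    {a b u : ℕ} (hA : A.encard ≤ (2 ^ a : ℕ))
    (hr : ∀ x ∈ A, {y | r x y}.encard ≤ (2 ^ b : ℕ))
    (hB : ∀ y ∈ B, ((2 ^ u : ℕ) : ℕ∞) ≤ {x | x ∈ A ∧ r x y}.encard) :
    B.encard ≤ (2 ^ (a + b - u) : ℕ) ∧ (B.Nonempty → u ≤ a + b) := by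
  classical
  have hfin : A.Finite := Set.finite_of_encard_le_coe hA
  have hAc : hfin.toFinset.card ≤ 2 ^ a := by
    rw [hfin.encard_eq_coe_toFinset_card] at hA
    exact_mod_cast hA
  have key : ∀ T : Finset β, (T : Set β) ⊆ B → T.card * 2 ^ u ≤ 2 ^ (a + b) := by
    intro T hT
    have h := Finset.card_mul_le_card_mul (s := T) (t := hfin.toFinset) (fun y x => r x y)
      (m := 2 ^ u) (n := 2 ^ b) ?_ ?_
    · exact h.trans (by rw [pow_add]; exact Nat.mul_le_mul_right _ hAc)
    · intro y hy
      have h1 := hB y (hT hy)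
      have h2 : {x | x ∈ A ∧ r x y} =
          (Finset.bipartiteAbove (fun y x => r x y) hfin.toFinset y : Set α) := by
        ext x; simp [Finset.bipartiteAbove]
      rw [h2, Set.encard_coe_eq_coe_finsetCard] at h1
      exact_mod_cast h1
    · intro x hx
      have h1 := hr x (by simpa using hx)
      have h2 : (Finset.bipartiteBelow (fun y x => r x y) T x : Set β) ⊆ {y | r x y} := by
        intro y hy
        exact (Finset.mem_filter.1 (Finset.mem_coe.1 hy)).2
      have h3 := (Set.encard_le_encard h2).trans h1
      rw [Set.encard_coe_eq_coe_finsetCard] at h3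
      exact_mod_cast h3
  have hu : B.Nonempty → u ≤ a + b := by
    rintro ⟨y, hy⟩
    have := key {y} (by simpa using hy)
    rw [Finset.card_singleton, one_mul] at this
    exact (Nat.pow_le_pow_iff_right (by norm_num)).1 this
  refine ⟨encard_le_of_forall_finset fun T hT => ?_, hu⟩
  rcases T.eq_empty_or_nonempty with rfl | ⟨y, hy⟩
  · simp
  · have h1 := key T hT
    have h2 := hu ⟨y, hT hy⟩
    have h3 : 2 ^ (a + b) = 2 ^ (a + b - u) * 2 ^ u := by
      rw [← pow_add]; congr 1; omega
    rw [h3] at h1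
    exact Nat.le_of_mul_le_mul_right h1 (by positivity)

theorem encard_pi_le {α : Type*} {k : ℕ} (H : Fin k → Set α) (h : Fin k → ℕ)
    (hH : ∀ j, (H j).encard ≤ (2 ^ h j : ℕ)) :
    {z : Fin k → α | ∀ j, z j ∈ H j}.encard ≤ (2 ^ ∑ j, h j : ℕ) := by
  classical
  have hfin : ∀ j, (H j).Finite := fun j => Set.finite_of_encard_le_coe (hH j)
  have heq : {z : Fin k → α | ∀ j, z j ∈ H j} =
      (Fintype.piFinset fun j => (hfin j).toFinset : Set (Fin k → α)) := by
    ext z; simp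
  rw [heq, Set.encard_coe_eq_coe_finsetCard, Fintype.card_piFinset, ← Finset.prod_pow_eq_pow_sum]
  have : ∏ j, (hfin j).toFinset.card ≤ ∏ j, 2 ^ h j := by
    refine Finset.prod_le_prod' fun j _ => ?_
    have := hH j
    rw [(hfin j).encard_eq_coe_toFinset_card] at this
    exact_mod_cast this
  exact_mod_cast this

theorem encard_setOf_length_eq (n : ℕ) : {y : BinStr | y.length = n}.encard ≤ (2 ^ n : ℕ) := by
  classical
  have hsub : {y : BinStr | y.length = n} ⊆
      ((Finset.univ : Finset (List.Vector Bool n)).image List.Vector.toList : Set BinStr) :=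
    fun y hy => by simpa using ⟨⟨y, hy⟩, rfl⟩
  refine (Set.encard_le_encard hsub).trans ?_
  rw [Set.encard_coe_eq_coe_finsetCard]
  exact_mod_cast Finset.card_image_le.trans (by simp [card_vector])

/-! ### Bounds for products with given irregularity -/

/-- Up to a logarithmic term, the complexity of a set is at most the total length of one of its
elements plus its irregularity, since it has complexity at most `i` given that element. This
bounds all numbers in the argument by a multiple of `i + n`. -/
theorem exists_K_le_of_mem {D : BinStr → BinStr →. BinStr} (hD : IsOptimalDecompressor D)
    {k : ℕ} {c : (Fin k → BinStr) ≃ BinStr} (hc : IsTupleCoding c) :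
    ∃ C : ℕ, ∀ (n i : ℕ) (w y : BinStr) (z : Fin k → BinStr), (∀ j, (z j).length = n) →
      K D w (c z) ≤ i → K D w y ≤ k * n + i + 1 + 2 * codeSize (n, i) + C := by
  let P : ((ℕ × ℕ) × BinStr) × BinStr → Prop := fun x =>
    ∃ z : Fin k → BinStr, (∀ j, (z j).length = x.1.1.1) ∧ K D x.2 (c z) ≤ x.1.1.2
  have hP : REPred P := by
    have h1 : REPred fun x : (((ℕ × ℕ) × BinStr) × BinStr) × (Fin k → BinStr) =>
        ∀ j, (x.2 j).length = x.1.1.1.1 := by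
      refine REPred.forall_fin (p := fun x : ((((ℕ × ℕ) × BinStr) × BinStr) × (Fin k → BinStr))
        × Fin k => (x.1.2 x.2).length = x.1.1.1.1.1) (PrimrecPred.rePred ?_)
      exact Primrec.eq.comp (Primrec.list_length.comp
        (Primrec.fin_app.comp (Primrec.snd.comp Primrec.fst) Primrec.snd))
        (Primrec.fst.comp (Primrec.fst.comp (Primrec.fst.comp (Primrec.fst.comp Primrec.fst))))
    have h2 : REPred fun x : (((ℕ × ℕ) × BinStr) × BinStr) × (Fin k → BinStr) =>
        K D x.1.2 (c x.2) ≤ x.1.1.1.2 :=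
      REPred.K_le hD (Computable.snd.comp Computable.fst) (hc.1.comp Computable.snd)
        (Computable.snd.comp (Computable.fst.comp (Computable.fst.comp Computable.fst)))
    exact (h1.and h2).exists
  obtain ⟨C, hC⟩ := exists_K_le_of_encard_le hD hP
  refine ⟨C, fun n i w y z hz hK => ?_⟩
  refine (hC (n, i) y w (k * n + (i + 1)) ⟨z, hz, hK⟩ ?_).trans (by omega)
  have hA : {z : Fin k → BinStr | ∀ j, z j ∈ {y : BinStr | y.length = n}}.encard ≤
      (2 ^ (k * n) : ℕ) := by
    simpa using encard_pi_le (fun _ : Fin k => {y : BinStr | y.length = n}) (fun _ => n)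
      fun _ => encard_setOf_length_eq n
  refine (encard_le_of_double_count (u := 0) (fun z w => K D w (c z) ≤ i) hA
    (fun z _ => encard_setOf_K_le hD (c z) i) ?_).1
  rintro w' ⟨z', hz', hK'⟩
  simpa [Set.one_le_encard_iff_nonempty] using ⟨z', hz', hK'⟩

/-- The elements `y` with `a ≤ K(w | y)` of the `j`-th projection of the set with code `w` do not
form an r.e. set, but if there are at most `2 ^ (t + 1)` of them, then they belong to an r.e. set
with at most that many elements. -/
theorem exists_thinned_projection {D : BinStr → BinStr →. BinStr} (hD : IsOptimalDecompressor D)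
    {k : ℕ} {e : Finset (Fin k → BinStr) ≃ BinStr} (he : IsSetCoding e) :
    ∃ Q : ((Fin k × ℕ × ℕ) × BinStr) × BinStr → Prop, REPred Q ∧
      (∀ j a t w, {y | Q (((j, a, t), w), y)}.encard ≤ (2 ^ (t + 1) : ℕ)) ∧
      ∀ j a t w, {y | (∃ z ∈ e.symm w, z j = y) ∧ a ≤ K D w y}.encard ≤ (2 ^ (t + 1) : ℕ) →
        ∀ y, (∃ z ∈ e.symm w, z j = y) → a ≤ K D w y → Q (((j, a, t), w), y) := by
  obtain ⟨g, hg, hge⟩ := he.2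
  have hmem : ∀ w j y, y ∈ (g w).map (fun z => z j) ↔ ∃ z ∈ e.symm w, z j = y := by
    intro w j y
    simp [← hge]
  have hp : REPred fun x : (ℕ × BinStr) × BinStr => K D x.1.2 x.2 < x.1.1 :=
    REPred.K_lt hD (Computable.snd.comp Computable.fst) Computable.snd
      (Computable.fst.comp Computable.fst)
  obtain ⟨q, hq, hqcard, hqmem⟩ := hp.exists_thinning
  obtain ⟨pow, hpow, hpow_eq⟩ : ∃ pow : ℕ → ℕ, Computable pow ∧ ∀ t, pow t = 2 ^ (t + 1) :=
    ⟨_, (primrec_two_pow.comp Primrec.succ).to_comp, fun _ => rfl⟩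
  obtain ⟨proj, hproj, hproj_eq⟩ : ∃ proj : List (Fin k → BinStr) → Fin k → List BinStr,
      Computable₂ proj ∧ ∀ l j, proj l j = l.map fun z => z j := by
    have h : Primrec₂ fun (l : List (Fin k → BinStr)) (j : Fin k) => l.map fun z => z j :=
      Primrec.list_map Primrec.fst
        (Primrec.fin_app.comp Primrec.snd (Primrec.snd.comp Primrec.fst))
    exact ⟨_, h.to_comp, fun _ _ => rfl⟩
  let f : ((Fin k × ℕ × ℕ) × BinStr) × BinStr → (((ℕ × BinStr) × List BinStr × ℕ) × BinStr) :=
    fun x => (((x.1.1.2.1, x.1.2), proj (g x.1.2) x.1.1.1, pow x.1.1.2.2), x.2)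
  have hf : Computable f := by
    have hj : Computable fun x : ((Fin k × ℕ × ℕ) × BinStr) × BinStr => x.1.1.1 :=
      Computable.fst.comp (Computable.fst.comp Computable.fst)
    have hat : Computable fun x : ((Fin k × ℕ × ℕ) × BinStr) × BinStr => x.1.1.2 :=
      Computable.snd.comp (Computable.fst.comp Computable.fst)
    have hw : Computable fun x : ((Fin k × ℕ × ℕ) × BinStr) × BinStr => x.1.2 :=
      Computable.snd.comp Computable.fst
    exact (((Computable.fst.comp hat).pair hw).pair ((hproj.comp (hg.comp hw) hj).pair
      (hpow.comp (Computable.snd.comp hat)))).pair Computable.snd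
  refine ⟨fun x => q (f x), hq.comp hf, ?_, ?_⟩
  · intro j a t w
    rw [← hpow_eq]
    exact hqcard (a, w) (proj (g w) j) (pow t)
  · intro j a t w hcard y hy hay
    refine hqmem _ _ _ ?_ y ?_ (not_lt.2 hay)
    · simpa only [hproj_eq, hpow_eq, hmem, not_lt] using hcard
    · rw [hproj_eq]
      exact (hmem _ _ _).2 hy

/-- The sets `H` generalize a projection `T = {y ∈ U_j : K(w | y) ≥ a}` of a set with code `w` and
`K(w) ≤ s`: they do not depend on `w`, they are r.e., and they have few elements, because each of
the elements lies in the thinned out projections of many sets `w'` with `K(w') ≤ s`. -/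
theorem exists_heavy_set {D : BinStr → BinStr →. BinStr} (hD : IsOptimalDecompressor D) {k : ℕ}
    {e : Finset (Fin k → BinStr) ≃ BinStr} (he : IsSetCoding e) :
    ∃ (H : (Fin k × ℕ × ℕ × ℕ × ℕ) × BinStr → Prop) (C : ℕ), REPred H ∧
      (∀ j s a t m, {y | H ((j, s, a, t, m), y)}.encard ≤ (2 ^ (s + 1 + (t + 1) - m) : ℕ) ∧
        ({y | H ((j, s, a, t, m), y)}.Nonempty → m ≤ s + 1 + (t + 1))) ∧
      ∀ j s a t w, K D w [] ≤ s →
        {y | (∃ z ∈ e.symm w, z j = y) ∧ a ≤ K D w y}.encard ≤ (2 ^ (t + 1) : ℕ) →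
        ∀ y, (∃ z ∈ e.symm w, z j = y) → a ≤ K D w y →
          H ((j, s, a, t, a - (2 * codeSize (s, j, a, t) + C + 1)), y) := by
  obtain ⟨Q, hQ, hQcard, hQmem⟩ := exists_thinned_projection hD he
  obtain ⟨pow, hpow, hpow_eq⟩ : ∃ pow : ℕ → ℕ, Computable pow ∧ ∀ m, pow m = 2 ^ m :=
    ⟨_, primrec_two_pow.to_comp, fun _ => rfl⟩
  let P : ((ℕ × Fin k × ℕ × ℕ) × BinStr) × BinStr → Prop := fun x =>
    K D x.2 [] ≤ x.1.1.1 ∧ Q ((x.1.1.2, x.2), x.1.2)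
  have hP : REPred P := by
    have hparam : Computable fun x : ((ℕ × Fin k × ℕ × ℕ) × BinStr) × BinStr => x.1.1 :=
      Computable.fst.comp Computable.fst
    refine (REPred.K_le hD Computable.snd (Computable.const []) (Computable.fst.comp hparam)).and
      (hQ.comp (f := fun x : ((ℕ × Fin k × ℕ × ℕ) × BinStr) × BinStr =>
        ((x.1.1.2, x.2), x.1.2)) ?_)
    exact ((Computable.snd.comp hparam).pair Computable.snd).pair
      (Computable.snd.comp Computable.fst)
  obtain ⟨C, hC⟩ := exists_K_le_of_encard_le hD hP
  let f : (Fin k × ℕ × ℕ × ℕ × ℕ) × BinStr → ((ℕ × Fin k × ℕ × ℕ) × BinStr) × ℕ := fun x =>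
    (((x.1.2.1, x.1.1, x.1.2.2.1, x.1.2.2.2.1), x.2), pow x.1.2.2.2.2)
  have hf : Computable f := by
    have h1 : Computable fun x : (Fin k × ℕ × ℕ × ℕ × ℕ) × BinStr => x.1.2 :=
      Computable.snd.comp Computable.fst
    have h2 : Computable fun x : (Fin k × ℕ × ℕ × ℕ × ℕ) × BinStr => x.1.2.2 :=
      Computable.snd.comp h1
    have h3 : Computable fun x : (Fin k × ℕ × ℕ × ℕ × ℕ) × BinStr => x.1.2.2.2 :=
      Computable.snd.comp h2
    exact (((Computable.fst.comp h1).pair ((Computable.fst.comp Computable.fst).pair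
      ((Computable.fst.comp h2).pair (Computable.fst.comp h3)))).pair Computable.snd).pair
      (hpow.comp (Computable.snd.comp h3))
  refine ⟨fun x => ((f x).2 : ℕ∞) ≤ {w | P ((f x).1, w)}.encard, C, hP.le_encard.comp hf, ?_, ?_⟩
  · intro j s a t m
    refine encard_le_of_double_count (A := {w | K D w [] ≤ s})
      (fun w y => Q (((j, a, t), w), y))
      (encard_setOf_K_le hD [] s) (fun w _ => hQcard _ _ _ _) fun y hy => ?_
    rw [← hpow_eq]
    exact hy
  · intro j s a t w hs hcard y hy hay
    have hP' : P (((s, j, a, t), y), w) := ⟨hs, hQmem _ _ _ _ hcard y hy hay⟩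
    change ((pow (a - (2 * codeSize (s, j, a, t) + C + 1)) : ℕ) : ℕ∞) ≤
      {w | P (((s, j, a, t), y), w)}.encard
    rw [hpow_eq]
    by_contra hcon
    have hlt := not_le.1 hcon
    have hK := hC (s, j, a, t) y w _ hP' hlt.le
    rcases Nat.lt_or_ge a (2 * codeSize (s, j, a, t) + C + 1) with h | h
    · -- the exponent is `0`, so that `w` alone is enough
      rw [Nat.sub_eq_zero_of_le h.le, pow_zero, Nat.cast_one] at hlt
      exact absurd (Set.encard_eq_zero.1 (by simpa using Order.lt_one_iff.1 hlt))
        (Set.Nonempty.ne_empty ⟨w, hP'⟩)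
    · omega

/-- If a set with code `w` contains `2 ^ u` tuples `z` with `K(w | z) ≤ i` that lie in a product
of heavy sets, then it is one of few sets that do. -/
theorem exists_K_le_of_heavy {D : BinStr → BinStr →. BinStr} (hD : IsOptimalDecompressor D) {k : ℕ}
    {c : (Fin k → BinStr) ≃ BinStr} (hc : IsTupleCoding c) {σ : Type*} [Primcodable σ]
    {H : (Fin k × σ) × BinStr → Prop} (hH : REPred H) :
    ∃ C : ℕ, ∀ (i u : ℕ) (f : Fin k → σ) (h : Fin k → ℕ) (w : BinStr),
      (∀ j, {y | H ((j, f j), y)}.encard ≤ (2 ^ h j : ℕ)) →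
      ((2 ^ u : ℕ) : ℕ∞) ≤ {z | K D w (c z) ≤ i ∧ ∀ j, H ((j, f j), z j)}.encard →
      K D w [] + u ≤ i + 1 + ∑ j, h j + 2 * codeSize (i, u, f) + C := by
  let R : (((ℕ × ℕ × (Fin k → σ)) × BinStr) × BinStr) × (Fin k → BinStr) → Prop := fun x =>
    K D x.1.2 (c x.2) ≤ x.1.1.1.1 ∧ ∀ j, H ((j, x.1.1.1.2.2 j), x.2 j)
  have hparam : Computable fun x : (((ℕ × ℕ × (Fin k → σ)) × BinStr) × BinStr) ×
      (Fin k → BinStr) => x.1.1.1 := Computable.fst.comp (Computable.fst.comp Computable.fst)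
  have hR : REPred R := by
    refine (REPred.K_le hD (Computable.snd.comp Computable.fst) (hc.1.comp Computable.snd)
      (Computable.fst.comp hparam)).and ?_
    refine REPred.forall_fin (p := fun x : ((((ℕ × ℕ × (Fin k → σ)) × BinStr) × BinStr) ×
      (Fin k → BinStr)) × Fin k => H ((x.2, x.1.1.1.1.2.2 x.2), x.1.2 x.2)) (hH.comp
        (f := fun x : ((((ℕ × ℕ × (Fin k → σ)) × BinStr) × BinStr) × (Fin k → BinStr)) × Fin k =>
          ((x.2, x.1.1.1.1.2.2 x.2), x.1.2 x.2)) ?_)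
    refine (Computable.snd.pair (Computable.fin_app.comp ?_ Computable.snd)).pair
      (Computable.fin_app.comp (Computable.snd.comp Computable.fst) Computable.snd)
    exact Computable.snd.comp (Computable.snd.comp (hparam.comp Computable.fst))
  let P : ((ℕ × ℕ × (Fin k → σ)) × BinStr) × BinStr → Prop := fun x =>
    ((2 ^ x.1.1.2.1 : ℕ) : ℕ∞) ≤ {z | R (x, z)}.encard
  have hP : REPred P := by
    have hpow : Computable fun x : ((ℕ × ℕ × (Fin k → σ)) × BinStr) × BinStr => 2 ^ x.1.1.2.1 := by
      exact primrec_two_pow.to_comp.comp (Computable.fst.comp (Computable.snd.comp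
        (Computable.fst.comp Computable.fst)))
    exact hR.le_encard.comp (f := fun x => (x, 2 ^ x.1.1.2.1)) (Computable.id.pair hpow)
  obtain ⟨C, hC⟩ := exists_K_le_of_encard_le hD hP
  refine ⟨C, fun i u f h w hcard hw => ?_⟩
  have hcount := encard_le_of_double_count (u := u) (B := {w' | P (((i, u, f), []), w')})
    (fun z w' => K D w' (c z) ≤ i) (encard_pi_le (fun j => {y | H ((j, f j), y)}) h hcard)
    (fun z _ => encard_setOf_K_le hD (c z) i) fun w' hw' => by
      refine le_of_le_of_eq hw' (congrArg _ ?_)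
      ext z
      exact and_comm
  have h1 := hC (i, u, f) [] w _ hw hcount.1
  have h2 := hcount.2 ⟨w, hw⟩
  omega

/-! ### The inequality -/

/-- The inequality with natural numbers, and with the binary length of `i(Π) + n` in place of the
logarithm. -/
theorem exists_sum_K_le {D : BinStr → BinStr →. BinStr} (hD : IsOptimalDecompressor D)
    {k : ℕ} {c : (Fin k → BinStr) ≃ BinStr} (hc : IsTupleCoding c)
    {e : Finset (Fin k → BinStr) ≃ BinStr} (he : IsSetCoding e) :
    ∃ C : ℕ, ∀ (n : ℕ) (U : Fin k → Finset BinStr), (∀ j, ∀ u ∈ U j, u.length = n) →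
      ∀ x ∈ Fintype.piFinset U, 1 ≤ irregularity D c e (Fintype.piFinset U) + n →
        ∑ j, K D (e (Fintype.piFinset U)) (x j) + K D (e (Fintype.piFinset U)) [] ≤
          k * K D (e (Fintype.piFinset U)) [] + irregularity D c e (Fintype.piFinset U) +
            C * Nat.size (irregularity D c e (Fintype.piFinset U) + n) := by
  classical
  obtain ⟨C₁, hC₁⟩ := exists_K_le_of_mem hD hc
  obtain ⟨H, C₂, hH, hHcard, hHmem⟩ := exists_heavy_set hD he
  obtain ⟨C₃, hC₃⟩ := exists_K_le_of_heavy (σ := ℕ × ℕ × ℕ × ℕ) hD hc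
    (H := fun x => H ((x.1.1, x.1.2), x.2)) hH
  -- `A * (i + n)` bounds all parameters, and `B * size (i + n)` their code sizes
  let A := k + 6 + C₁
  let B := Nat.size A + Nat.size k + 1
  refine ⟨1 + 2 * k + 64 * 3 ^ k * B + C₃ + k * (16 * B + C₂ + 1), fun n U hU x hx hN => ?_⟩
  set S := Fintype.piFinset U with hS
  set w := e S with hw
  set s := K D w [] with hs
  set i := irregularity D c e S with hi
  have hKi : ∀ z ∈ S, K D w (c z) ≤ i := fun z hz =>
    Finset.le_sup (f := fun x => K D (e S) (c x)) hz
  have hlen : ∀ z ∈ S, ∀ j, (z j).length = n := fun z hz j =>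
    hU j _ (Fintype.mem_piFinset.1 hz j)
  set L := Nat.size (i + n) with hL
  have hL1 : 1 ≤ L := Nat.size_pos.2 hN
  have hprior : ∀ y, K D w y ≤ A * (i + n) := by
    intro y
    refine (hC₁ n i w y x (hlen x hx) (hKi x hx)).trans ?_
    have h1 : codeSize (n, i) ≤ 2 * (i + n) :=
      codeSize_pair_le ((Nat.size_le_size (Nat.le_add_left n i)).trans (size_le_self _))
        ((Nat.size_le_size (Nat.le_add_right i n)).trans (size_le_self _))
    have h2 : A * (i + n) = k * (i + n) + 6 * (i + n) + C₁ * (i + n) := by simp only [A]; ring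
    have h3 : C₁ * 1 ≤ C₁ * (i + n) := Nat.mul_le_mul_left _ hN
    have h4 : k * n ≤ k * (i + n) := Nat.mul_le_mul_left _ (Nat.le_add_left _ _)
    omega
  have hsize : ∀ v, v ≤ A * (i + n) → codeSize v ≤ B * L := by
    intro v hv
    have h1 : Nat.size v ≤ Nat.size A + L := (Nat.size_le_size hv).trans (size_mul_le _ _)
    have h2 : Nat.size A * 1 ≤ Nat.size A * L := Nat.mul_le_mul_left _ hL1
    have h3 : B * L = Nat.size A * L + Nat.size k * L + L := by simp only [B]; ring
    rw [codeSize_nat]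
    omega
  have hsizek : ∀ j : Fin k, codeSize j ≤ B * L := by
    intro j
    have h1 := codeSize_fin j
    have h2 : Nat.size k * 1 ≤ Nat.size k * L := Nat.mul_le_mul_left _ hL1
    have h3 : B * L = Nat.size A * L + Nat.size k * L + L := by simp only [B]; ring
    omega
  have hBL : 1 ≤ B * L := Nat.mul_pos (by simp [B]) hL1
  have hnA : i + n ≤ A * (i + n) := Nat.le_mul_of_pos_left _ (by simp only [A]; omega)
  have hproj : ∀ j y, (∃ z ∈ e.symm w, z j = y) ↔ y ∈ U j := by
    intro j y
    rw [hw, Equiv.symm_apply_apply]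
    constructor
    · rintro ⟨z, hz, rfl⟩
      exact Fintype.mem_piFinset.1 hz j
    · intro hy
      refine ⟨Function.update x j y, Fintype.mem_piFinset.2 fun j' => ?_, by simp⟩
      rcases eq_or_ne j' j with rfl | hj
      · simpa using hy
      · simpa [hj] using Fintype.mem_piFinset.1 hx j'
  let a : Fin k → ℕ := fun j => K D w (x j)
  let T : Fin k → Finset BinStr := fun j => (U j).filter fun y => a j ≤ K D w y
  let t : Fin k → ℕ := fun j => Nat.log 2 (T j).card
  have hxT : ∀ j, x j ∈ T j := fun j =>
    Finset.mem_filter.2 ⟨Fintype.mem_piFinset.1 hx j, le_rfl⟩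
  have hTpos : ∀ j, (T j).card ≠ 0 := fun j => Finset.card_ne_zero_of_mem (hxT j)
  have htle : ∀ j, 2 ^ t j ≤ (T j).card := fun j => Nat.pow_log_le_self 2 (hTpos j)
  have hlt : ∀ j, (T j).card < 2 ^ (t j + 1) := fun j => Nat.lt_pow_succ_log_self (by norm_num) _
  have htn : ∀ j, t j ≤ n := by
    intro j
    have h1 : ((T j : Set BinStr)).encard ≤ (2 ^ n : ℕ) :=
      (Set.encard_le_encard fun y hy => hU j y (Finset.mem_filter.1 (Finset.mem_coe.1 hy)).1).trans
        (encard_setOf_length_eq n)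
    rw [Set.encard_coe_eq_coe_finsetCard] at h1
    exact (Nat.pow_le_pow_iff_right (by norm_num)).1 ((htle j).trans (by exact_mod_cast h1))
  let ov : ℕ := 16 * (B * L) + C₂ + 1
  have hov : ∀ j, 2 * codeSize (s, j, a j, t j) + C₂ + 1 ≤ ov := by
    intro j
    have hB2 : B * L ≤ 2 * (B * L) := by omega
    have h1 := codeSize_pair_le (hsize (a j) (hprior _))
      (hsize (t j) ((htn j).trans ((Nat.le_add_left n i).trans hnA)))
    have h2 := codeSize_pair_le ((hsizek j).trans hB2) h1
    have h3 := codeSize_pair_le (((hsize s (hprior _)).trans hB2).trans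
      (Nat.le_mul_of_pos_left (2 * (B * L)) (by norm_num : 0 < 2))) h2
    simp only [ov]
    omega
  let m : Fin k → ℕ := fun j => a j - (2 * codeSize (s, j, a j, t j) + C₂ + 1)
  have hTH : ∀ j, ∀ y ∈ T j, H ((j, s, a j, t j, m j), y) := by
    intro j y hy
    obtain ⟨hyU, hya⟩ := Finset.mem_filter.1 hy
    refine hHmem j s (a j) (t j) w le_rfl ?_ y ((hproj j y).2 hyU) hya
    have h1 : {y | (∃ z ∈ e.symm w, z j = y) ∧ a j ≤ K D w y} = (T j : Set BinStr) := by
      ext y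
      rw [Finset.mem_coe, Finset.mem_filter, ← hproj]
      rfl
    rw [h1, Set.encard_coe_eq_coe_finsetCard]
    exact_mod_cast (hlt j).le
  have hmle : ∀ j, m j ≤ s + 1 + (t j + 1) := fun j =>
    (hHcard j s (a j) (t j) (m j)).2 ⟨x j, hTH j _ (hxT j)⟩
  have hmain := hC₃ i (∑ j, t j) (fun j => (s, a j, t j, m j)) (fun j => s + 1 + (t j + 1) - m j) w
    (fun j => (hHcard j s (a j) (t j) (m j)).1) (by
      have hsub : (Fintype.piFinset T : Set (Fin k → BinStr)) ⊆
          {z | K D w (c z) ≤ i ∧ ∀ j, H ((j, s, a j, t j, m j), z j)} := by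
        intro z hz
        have hz' := Fintype.mem_piFinset.1 (Finset.mem_coe.1 hz)
        exact ⟨hKi z (Fintype.mem_piFinset.2 fun j => (Finset.mem_filter.1 (hz' j)).1),
          fun j => hTH j _ (hz' j)⟩
      refine le_trans ?_ (Set.encard_le_encard hsub)
      rw [Set.encard_coe_eq_coe_finsetCard, Fintype.card_piFinset, ← Finset.prod_pow_eq_pow_sum]
      exact_mod_cast Finset.prod_le_prod' fun j _ => htle j)
  have hcode : codeSize (i, ∑ j, t j, fun j => (s, a j, t j, m j)) ≤ 32 * 3 ^ k * (B * L) := by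
    have h1 : codeSize (fun j => (s, a j, t j, m j)) ≤ 3 ^ k * (2 * (2 * (2 * (B * L)))) := by
      refine codeSize_pi_le (by omega) _ fun j => ?_
      refine codeSize_pair_le ((hsize s (hprior _)).trans (by omega)) (codeSize_pair_le
        ((hsize (a j) (hprior _)).trans (by omega)) (codeSize_pair_le (hsize (t j) ?_)
          (hsize (m j) ?_)))
      · exact (htn j).trans ((Nat.le_add_left n i).trans hnA)
      · exact (Nat.sub_le _ _).trans (hprior _)
    have h2 : B * L ≤ 3 ^ k * (B * L) := Nat.le_mul_of_pos_left _ (by positivity)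
    have h3 : ∑ j, t j ≤ A * (i + n) := by
      calc ∑ j, t j ≤ ∑ _j : Fin k, n := Finset.sum_le_sum fun j _ => htn j
        _ = k * n := by simp
        _ ≤ A * (i + n) := Nat.mul_le_mul (by simp only [A]; omega) (Nat.le_add_left n i)
    refine (codeSize_pair_le (S := 16 * (3 ^ k * (B * L)))
      ((hsize i ((Nat.le_add_right i n).trans hnA)).trans (by omega))
      ((codeSize_pair_le (S := 8 * (3 ^ k * (B * L))) ((hsize _ h3).trans (by omega))
        (h1.trans (by linarith))).trans (by omega))).trans (by linarith)
  have hsum : ∑ j, (s + 1 + (t j + 1) - m j) + ∑ j, a j ≤ k * (s + 2 + ov) + ∑ j, t j := by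
    have h1 : k * (s + 2 + ov) = ∑ _j : Fin k, (s + 2 + ov) := by simp
    rw [h1, ← Finset.sum_add_distrib, ← Finset.sum_add_distrib]
    refine Finset.sum_le_sum fun j _ => ?_
    have h2 := hmle j
    have h3 := hov j
    simp only [m] at h2 ⊢
    omega
  have hfinal : (1 + 2 * k + 64 * 3 ^ k * B + C₃ + k * (16 * B + C₂ + 1)) * L =
      L + (2 * k) * L + 2 * (32 * 3 ^ k * (B * L)) + C₃ * L + k * (16 * (B * L))
        + (k * C₂) * L + k * L := by ring
  have hov_eq : k * (s + 2 + ov) = k * s + 2 * k + k * (16 * (B * L)) + k * C₂ + k := by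
    simp only [ov]; ring
  have h1 := Nat.le_mul_of_pos_right (2 * k) hL1
  have h2 := Nat.le_mul_of_pos_right C₃ hL1
  have h3 := Nat.le_mul_of_pos_right (k * C₂) hL1
  have h4 := Nat.le_mul_of_pos_right k hL1
  rw [hfinal]
  rw [hov_eq] at hsum
  change ∑ j, a j + s ≤ _
  linarith

theorem proposition2 (D : BinStr → BinStr →. BinStr) (hD : IsOptimalDecompressor D)
    (k : ℕ) (hk : 1 ≤ k)
    (c : (Fin k → BinStr) ≃ BinStr) (hc : IsTupleCoding c)
    (e : Finset (Fin k → BinStr) ≃ BinStr) (he : IsSetCoding e) :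
    ∃ Γ : ℝ, 0 < Γ ∧
      ∀ (n : ℕ) (U : Fin k → Finset BinStr), (∀ j, ∀ u ∈ U j, u.length = n) →
        ∀ x ∈ Fintype.piFinset U,
          2 ≤ irregularity D c e (Fintype.piFinset U) + n →
          ∑ j, (K D (e (Fintype.piFinset U)) (x j) : ℝ) ≤
            ((k : ℝ) - 1) * (K D (e (Fintype.piFinset U)) [] : ℝ)
              + (irregularity D c e (Fintype.piFinset U) : ℝ)
              + Γ * Real.logb 2 ((irregularity D c e (Fintype.piFinset U) : ℝ) + n) := by
  obtain ⟨C, hC⟩ := exists_sum_K_le hD hc he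
  refine ⟨2 * C + 1, by positivity, fun n U hU x hx hN => ?_⟩
  have hnat := hC n U hU x hx (by omega)
  set i := irregularity D c e (Fintype.piFinset U)
  set s := K D (e (Fintype.piFinset U)) []
  have hreal : (∑ j, (K D (e (Fintype.piFinset U)) (x j) : ℝ)) + s ≤
      k * s + i + C * Nat.size (i + n) := by exact_mod_cast hnat
  have hNR : (2 : ℝ) ≤ (i : ℝ) + n := by exact_mod_cast hN
  -- as `i + n ≥ 2`, its binary length is at most twice its logarithm
  have hlog1 : 1 ≤ Real.logb 2 ((i : ℝ) + n) := by
    rw [Real.le_logb_iff_rpow_le (by norm_num) (by linarith)]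
    simpa using hNR
  have hsize : (Nat.size (i + n) : ℝ) ≤ 2 * Real.logb 2 ((i : ℝ) + n) := by
    have h1 : 1 ≤ Nat.size (i + n) := Nat.size_pos.2 (by omega)
    have h2 : 2 ^ (Nat.size (i + n) - 1) ≤ i + n := Nat.lt_size.1 (by omega)
    have h3 : ((Nat.size (i + n) - 1 : ℕ) : ℝ) ≤ Real.logb 2 ((i : ℝ) + n) := by
      rw [Real.le_logb_iff_rpow_le (by norm_num) (by linarith), Real.rpow_natCast]
      exact_mod_cast h2
    rw [Nat.cast_sub h1] at h3
    push_cast at h3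
    linarith
  have hCsize := mul_le_mul_of_nonneg_left hsize (Nat.cast_nonneg (α := ℝ) C)
  linarith
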